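/- Let $\mathcal X$ be a finite alphabet and let $P_0,P_1$ be any two probability distributions on $\mathcal X$ (zero masses are allowed). For a finite alphabet $\mathcal Y$, a mechanism $W:\mathcal X\to\mathcal Y$ assigns to every $x\in\mathcal X$ a probability distribution $W(\cdot\mid x)$ on $\mathcal Y$; it is $\varepsilon$-locally differentially private ($\varepsilon$-LDP) if $W(S\mid x)\le e^{\varepsilon}\,W(S\mid x')$ for all $x,x'\in\mathcal X$ and all $S\subseteq\mathcal Y$. Write $Q_i(y)=\sum_{x}P_i(x)W(y\mid x)$, $i\in\{0,1\}$, for the induced output distributions, and $$I_{ch}(Q_0,Q_1)=-\inf_{\lambda\in(0,1)}\log\sum_{y}Q_0(y)^{\lambda}Q_1(y)^{1-\lambda}$$ for their Chernoff information. For $\tau>0$, the binary mechanism $W^b_\tau:\mathcal X\to\{0,1\}$ first maps $x$ to the bit $v=0$ if $P_0(x)\ge\tau P_1(x)$ and to $v=1$ otherwise, and then outputs $y=v$ with probability $\frac{e^\varepsilon}{e^\varepsilon+1}$ and $y=1-v$ with probability $\frac{1}{e^\varepsilon+1}$; let $(Q_0^\tau,Q_1^\tau)$ be its output distributions. The binary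 mechanism is used with an optimal threshold $\tau^*\in\arg\max_{\tau>0}I_{ch}(Q_0^\tau,Q_1^\tau)$. Then there is a threshold $\varepsilon'=\varepsilon'(P_0,P_1)>0$ such that for every $\varepsilon$ with $0\le\varepsilon\le\varepsilon'$ an optimal threshold exists, and for every optimal threshold $\tau^*$ the binary mechanism $W^b_{\tau^*}$ is $\varepsilon$-LDP and maximizes $I_{ch}(Q_0,Q_1)$ among all $\varepsilon$-LDP mechanisms $W:\mathcal X\to\mathcal Y$ with an arbitrary finite output alphabet $\mathcal Y$. -/

import Mathlib

namespace LDP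

noncomputable section

/-- A channel (randomized mechanism) between finite alphabets: `W x y` is the conditional
probability `W(y | x)`, and every row is a probability vector. -/
def IsChannel {X Y : Type*} [Fintype Y] (W : X → Y → ℝ) : Prop :=
  ∀ x, W x ∈ stdSimplex ℝ Y

/-- The distribution `Q(y) = ∑ x, P(x) W(y | x)` induced by passing `P` through `W`. -/
def induced {X Y : Type*} [Fintype X] (P : X → ℝ) (W : X → Y → ℝ) : Y → ℝ :=
  fun y => ∑ x, P x * W x y

/-- `W` is an `ε`-locally differentially private mechanism:
`W(S | x) ≤ e ^ ε * W(S | x')` for all inputs `x, x'` and all sets `S` of outputs. -/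
def IsLDP {X Y : Type*} [Fintype Y] (ε : ℝ) (W : X → Y → ℝ) : Prop :=
  IsChannel W ∧
    ∀ (x x' : X) (S : Finset Y), ∑ y ∈ S, W x y ≤ Real.exp ε * ∑ y ∈ S, W x' y

/-- Chernoff information `- inf_{0 < l < 1} log (∑ x, P₀(x) ^ l * P₁(x) ^ (1 - l))`, with values
in the extended reals, where `log 0 = -∞`. The infimum is a minimum whenever `P₀` and `P₁`
have the same support, as all pairs induced by a locally private mechanism do. -/
def chernoffInfo {X : Type*} [Fintype X] (P₀ P₁ : X → ℝ) : EReal :=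
  - ⨅ l ∈ Set.Ioo (0 : ℝ) 1,
      ENNReal.log (ENNReal.ofReal (∑ x, P₀ x ^ l * P₁ x ^ (1 - l)))

/-- The quantizer `Z_τ`: bit `0` on `{x | P₀(x) ≥ τ P₁(x)}` and bit `1` elsewhere. -/
def quantizer {X : Type*} (P₀ P₁ : X → ℝ) (τ : ℝ) (x : X) : Fin 2 :=
  if P₀ x ≥ τ * P₁ x then 0 else 1

/-- The deterministic channel `Z_τ(v | x) = 1{Z_τ(x) = v}` of the quantizer. -/
def quantizerChannel {X : Type*} (P₀ P₁ : X → ℝ) (τ : ℝ) (x : X) (v : Fin 2) : ℝ :=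
  if quantizer P₀ P₁ τ x = v then 1 else 0

/-- Binary randomized response with privacy parameter `ε`. -/
def binaryRR (ε : ℝ) (v y : Fin 2) : ℝ :=
  if y = v then Real.exp ε / (Real.exp ε + 1) else 1 / (Real.exp ε + 1)

/-- The binary mechanism with threshold `τ`: the quantizer followed by binary randomized
response, i.e. the product of the two transition matrices. -/
def binaryMechanism {X : Type*} (P₀ P₁ : X → ℝ) (τ ε : ℝ) (x : X) : Fin 2 → ℝ :=
  induced (quantizerChannel P₀ P₁ τ x) (binaryRR ε)

/-- Chernoff information between the outputs of the mechanism `W` on the inputs `P₀` and `P₁`. -/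
def inducedChernoff {X Y : Type*} [Fintype X] [Fintype Y] (P₀ P₁ : X → ℝ) (W : X → Y → ℝ) :
    EReal :=
  chernoffInfo (induced P₀ W) (induced P₁ W)

/-- `τ` is an optimal threshold `τ* ∈ argmax_{τ > 0} I_ch(Q₀^τ, Q₁^τ)`, where `Q₀^τ, Q₁^τ` are
the outputs of the binary mechanism with threshold `τ`. -/
def IsOptimalThreshold {X : Type*} [Fintype X] (P₀ P₁ : X → ℝ) (ε τ : ℝ) : Prop :=
  0 < τ ∧ ∀ τ' : ℝ, 0 < τ' →
    inducedChernoff P₀ P₁ (binaryMechanism P₀ P₁ τ' ε) ≤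
      inducedChernoff P₀ P₁ (binaryMechanism P₀ P₁ τ ε)

end

end LDP

/-! For fixed `l` the affinity `∑ y, Q₀(y) ^ l * Q₁(y) ^ (1 - l)` is one minus the sum over outputs
of `meanGap`, a convex function that is homogeneous of degree one. With `δ = exp ε - 1`, each column
of a private channel is a nonnegative multiple of some `1 + δ u`, `u ∈ [0,1]^X`
(`IsLDP.exists_column`). Minimizing the affinity is thus a linear program over weighted columns,
whose constraints say that the rows sum to one. A dual solution is `n : X → ℝ` with `columnGap ≤ ∑
x, n x * (1 + δ * u x)` on the cube; it bounds every private channel by `∑ x, n x`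
(`one_sub_sum_certificate_le`). By convexity only the vertices, that is the subsets of `X`, need
checking.

To leading order, `columnGap` is `l (1 - l) / 2 * δ² * (a - b)²` (`le_columnGap`, `columnGap_le`).
For small `δ` it therefore favours the sets that attain the total variation `D`: those that separate
`{P₀ > P₁}` from `{P₀ < P₁}`, with ties placed arbitrarily. Every other set loses at least `γ`, the
least nonzero `|P₀ x - P₁ x|`, in `|a - b|`, which outweighs the higher order terms once `16 δ ≤ γ`,
uniformly in `l`. Among the separating sets, convexity puts the optimum at all ties on one side;
`exists_certificate` builds a dual solution matching the better of these two partitions.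

The two partitions are realized by the thresholds `1` and `1 + γ`. Which one wins may depend on `l`,
but the larger of their two Chernoff informations bounds that of every private mechanism
(`inducedChernoff_le`). -/

namespace LDP

/-! ### Algebra and convexity of the mean gap -/

/-- The gap between the weighted arithmetic and geometric means of two numbers. -/
noncomputable def meanGap (l p q : ℝ) : ℝ := l * p + (1 - l) * q - p ^ l * q ^ (1 - l)

lemma meanGap_swap (l p q : ℝ) : meanGap (1 - l) q p = meanGap l p q := by
  unfold meanGap
  rw [sub_sub_cancel]
  ring

lemma meanGap_self {l p : ℝ} (hp : 0 ≤ p) : meanGap l p p = 0 := by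
  unfold meanGap
  rw [← Real.rpow_add' hp (by simp)]
  simp
  ring

lemma meanGap_mul {l c p q : ℝ} (hc : 0 ≤ c) (hp : 0 ≤ p) (hq : 0 ≤ q) :
    meanGap l (c * p) (c * q) = c * meanGap l p q := by
  unfold meanGap
  rw [Real.mul_rpow hc hp, Real.mul_rpow hc hq]
  have : c ^ l * c ^ (1 - l) = c := by
    rw [← Real.rpow_add' hc (by simp)]
    simp
  linear_combination (- p ^ l * q ^ (1 - l)) * this

/-- The linear part cancels, so the claim is concavity of `p ^ l * q ^ (1 - l)`. Normalizing by the
values `P`, `Q` at the combined point, weighted AM-GM gives the tangent plane bound there; averaging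
it over the two points gives the claim. -/
lemma meanGap_convex {l : ℝ} (h0 : 0 ≤ l) (h1 : l ≤ 1) {s t p q p' q' : ℝ} (hs : 0 ≤ s)
    (ht : 0 ≤ t) (hst : s + t = 1) (hp : 0 < p) (hq : 0 < q) (hp' : 0 < p') (hq' : 0 < q') :
    meanGap l (s * p + t * p') (s * q + t * q') ≤ s * meanGap l p q + t * meanGap l p' q' := by
  have pos : ∀ {u v : ℝ}, 0 < u → 0 < v → 0 < s * u + t * v := by
    intro u v hu hv
    rcases hs.eq_or_lt with rfl | hs
    · simp_all
    · positivity
  have hP := pos hp hp'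
  have hQ := pos hq hq'
  set P := s * p + t * p' with hPdef
  set Q := s * q + t * q' with hQdef
  have amgm : ∀ {u v : ℝ}, 0 < u → 0 < v →
      u ^ l * v ^ (1 - l) ≤ P ^ l * Q ^ (1 - l) * (l * (u / P) + (1 - l) * (v / Q)) := by
    intro u v hu hv
    have h := Real.geom_mean_le_arith_mean2_weighted h0 (sub_nonneg.2 h1)
      (div_pos hu hP).le (div_pos hv hQ).le (by ring)
    have e : u ^ l * v ^ (1 - l) = P ^ l * Q ^ (1 - l) * ((u / P) ^ l * (v / Q) ^ (1 - l)) := by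
      rw [Real.div_rpow hu.le hP.le, Real.div_rpow hv.le hQ.le]
      have := Real.rpow_pos_of_pos hP l
      have := Real.rpow_pos_of_pos hQ (1 - l)
      field_simp
    rw [e]
    gcongr
  have e1 := mul_le_mul_of_nonneg_left (amgm hp hq) hs
  have e2 := mul_le_mul_of_nonneg_left (amgm hp' hq') ht
  have e3 : s * (l * (p / P) + (1 - l) * (q / Q)) + t * (l * (p' / P) + (1 - l) * (q' / Q)) = 1 := by
    have : l * ((s * p + t * p') / P) + (1 - l) * ((s * q + t * q') / Q) = 1 := by
      rw [← hPdef, ← hQdef, div_self hP.ne', div_self hQ.ne']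
      ring
    refine Eq.trans ?_ this
    ring
  have e4 : s * (p ^ l * q ^ (1 - l)) + t * (p' ^ l * q' ^ (1 - l)) ≤ P ^ l * Q ^ (1 - l) := by
    calc _ ≤ P ^ l * Q ^ (1 - l) * (s * (l * (p / P) + (1 - l) * (q / Q)) +
          t * (l * (p' / P) + (1 - l) * (q' / Q))) := by linarith
      _ = _ := by rw [e3, mul_one]
  unfold meanGap
  nlinarith [e4]

/-! ### Second order bounds on the mean gap -/

/-- In logarithmic coordinates the mean gap is the Jensen gap of `exp`. Convexity of this
difference, and of the one in `convexOn_sq_sub_exp`, compares it with the Jensen gap of `x ^ 2 / 2`,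
which is exactly `l (1 - l) / 2` times the squared distance. -/
lemma convexOn_exp_sub_sq : ConvexOn ℝ (Set.Ici 0) fun x : ℝ => Real.exp x - x ^ 2 / 2 := by
  have d1 : deriv (fun x : ℝ => Real.exp x - x ^ 2 / 2) = fun x => Real.exp x - x := by
    ext x
    exact (HasDerivAt.congr_deriv (f := fun x : ℝ => Real.exp x - x ^ 2 / 2)
      ((Real.hasDerivAt_exp x).sub ((hasDerivAt_pow 2 x).div_const 2)) (by simp)).deriv
  apply convexOn_of_deriv2_nonneg (convex_Ici 0) (by fun_prop) (by fun_prop)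
  · rw [d1]
    fun_prop
  · intro x hx
    have d2 : deriv (fun x : ℝ => Real.exp x - x) x = Real.exp x - 1 :=
      ((Real.hasDerivAt_exp x).sub (hasDerivAt_id x)).deriv
    rw [interior_Ici] at hx
    simp only [Function.iterate_succ, Function.iterate_zero, Function.comp_apply, id, d1, d2]
    exact sub_nonneg.2 (Real.one_le_exp (le_of_lt hx))

lemma convexOn_sq_sub_exp (B : ℝ) :
    ConvexOn ℝ (Set.Iic B) fun x : ℝ => Real.exp B * (x ^ 2 / 2) - Real.exp x := by
  have d1 : deriv (fun x : ℝ => Real.exp B * (x ^ 2 / 2) - Real.exp x) =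
      fun x => Real.exp B * x - Real.exp x := by
    ext x
    exact (HasDerivAt.congr_deriv (f := fun x : ℝ => Real.exp B * (x ^ 2 / 2) - Real.exp x)
      ((((hasDerivAt_pow 2 x).div_const 2).const_mul (Real.exp B)).sub
        (Real.hasDerivAt_exp x)) (by simp)).deriv
  apply convexOn_of_deriv2_nonneg (convex_Iic B) (by fun_prop) (by fun_prop)
  · rw [d1]
    fun_prop
  · intro x hx
    have d2 : deriv (fun x : ℝ => Real.exp B * x - Real.exp x) x = Real.exp B - Real.exp x :=
      (HasDerivAt.congr_deriv (f := fun x : ℝ => Real.exp B * x - Real.exp x)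
        (((hasDerivAt_id x).const_mul (Real.exp B)).sub (Real.hasDerivAt_exp x))
        (by simp)).deriv
    rw [interior_Iic] at hx
    simp only [Function.iterate_succ, Function.iterate_zero, Function.comp_apply, id, d1, d2]
    exact sub_nonneg.2 (Real.exp_le_exp.2 (le_of_lt hx))

lemma meanGap_eq_exp {l p q : ℝ} (hp : 0 < p) (hq : 0 < q) :
    meanGap l p q = l * Real.exp (Real.log p) + (1 - l) * Real.exp (Real.log q)
      - Real.exp (l * Real.log p + (1 - l) * Real.log q) := by
  unfold meanGap
  rw [Real.exp_log hp, Real.exp_log hq, Real.rpow_def_of_pos hp, Real.rpow_def_of_pos hq,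
    ← Real.exp_add]
  ring_nf

lemma le_meanGap {l p q δ : ℝ} (h0 : 0 ≤ l) (h1 : l ≤ 1) (hp : 1 ≤ p) (hpδ : p ≤ 1 + δ)
    (hq : 1 ≤ q) (hqδ : q ≤ 1 + δ) :
    (1 - 2 * δ) * (l * (1 - l) / 2 * (p - q) ^ 2) ≤ meanGap l p q := by
  wlog hqp : q ≤ p generalizing l p q
  · have := this (sub_nonneg.2 h1) (by linarith) hq hqδ hp hpδ (not_le.1 hqp).le
    rw [meanGap_swap] at this
    refine le_trans (le_of_eq ?_) this
    ring
  have hp0 : 0 < p := by linarith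
  have hq0 : 0 < q := by linarith
  have h := convexOn_exp_sub_sq.2 (x := Real.log p) (y := Real.log q) (Real.log_nonneg hp)
    (Real.log_nonneg hq) h0 (sub_nonneg.2 h1) (by ring)
  simp only [smul_eq_mul] at h
  have hk : 0 ≤ l * (1 - l) / 2 := by
    have := sub_nonneg.2 h1
    positivity
  -- Returns from logarithms to the masses; the loss `(1 + δ)⁻²` is then weakened to `1 - 2δ`.
  have hlog : (p - q) / (1 + δ) ≤ Real.log p - Real.log q := by
    rw [← Real.log_div hp0.ne' hq0.ne']
    have := Real.one_sub_inv_le_log_of_pos (div_pos hp0 hq0)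
    rw [inv_div] at this
    refine le_trans ?_ this
    rw [one_sub_div hp0.ne']
    have : 0 ≤ p - q := by linarith
    gcongr
  have hδ : 0 < 1 + δ := by linarith
  have hsq : (1 - 2 * δ) * (p - q) ^ 2 ≤ (Real.log p - Real.log q) ^ 2 := by
    have h2 : ((p - q) / (1 + δ)) ^ 2 ≤ (Real.log p - Real.log q) ^ 2 := by
      have : 0 ≤ p - q := by linarith
      gcongr
    refine le_trans ?_ h2
    rw [div_pow, le_div_iff₀ (by positivity)]
    have : (1 - 2 * δ) * (1 + δ) ^ 2 ≤ 1 := by nlinarith [sq_nonneg δ]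
    nlinarith [mul_le_mul_of_nonneg_right this (sq_nonneg (p - q))]
  rw [meanGap_eq_exp hp0 hq0]
  nlinarith [mul_le_mul_of_nonneg_left hsq hk]

lemma meanGap_le {l p q δ : ℝ} (h0 : 0 ≤ l) (h1 : l ≤ 1) (hp : 1 ≤ p) (hpδ : p ≤ 1 + δ)
    (hq : 1 ≤ q) (hqδ : q ≤ 1 + δ) :
    meanGap l p q ≤ (1 + δ) * (l * (1 - l) / 2 * (p - q) ^ 2) := by
  wlog hqp : q ≤ p generalizing l p q
  · have := this (sub_nonneg.2 h1) (by linarith) hq hqδ hp hpδ (not_le.1 hqp).le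
    rw [meanGap_swap] at this
    refine le_trans this (le_of_eq ?_)
    ring
  have hp0 : 0 < p := by linarith
  have hq0 : 0 < q := by linarith
  have hδ : 0 < 1 + δ := by linarith
  have h := (convexOn_sq_sub_exp (Real.log (1 + δ))).2 (x := Real.log p) (y := Real.log q)
    (Real.log_le_log hp0 hpδ) (Real.log_le_log hq0 hqδ) h0 (sub_nonneg.2 h1) (by ring)
  simp only [smul_eq_mul, Real.exp_log hδ] at h
  have hk : 0 ≤ l * (1 - l) / 2 := by
    have := sub_nonneg.2 h1
    positivity
  have hlog : Real.log p - Real.log q ≤ p - q := by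
    rw [← Real.log_div hp0.ne' hq0.ne']
    refine (Real.log_le_sub_one_of_pos (div_pos hp0 hq0)).trans ?_
    rw [div_sub_one hq0.ne']
    exact div_le_self (by linarith) hq
  have hsq : (Real.log p - Real.log q) ^ 2 ≤ (p - q) ^ 2 := by
    have : 0 ≤ Real.log p - Real.log q := sub_nonneg.2 (Real.log_le_log hq0 hqp)
    gcongr
  rw [meanGap_eq_exp hp0 hq0]
  nlinarith [mul_le_mul_of_nonneg_left hsq (mul_nonneg hδ.le hk)]

/-! ### Reduction to vertices and estimates for columns -/

/-- The cube is the convex hull of its vertices, and a convex function on a hull is dominated by its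
value at some generator. -/
lemma le_of_convexOn_of_vertices {X : Type*} [Finite X] {f : (X → ℝ) → ℝ}
    (hf : ConvexOn ℝ (Set.Icc 0 1) f) {c : ℝ} (h : ∀ v, (∀ x, v x = 0 ∨ v x = 1) → f v ≤ c)
    {u : X → ℝ} (hu : u ∈ Set.Icc 0 1) : f u ≤ c := by
  have hmem : u ∈ convexHull ℝ (Set.univ.pi fun _ : X => ({0, 1} : Set ℝ)) := by
    refine mem_convexHull_pi fun x _ => ?_
    rw [convexHull_pair, segment_eq_Icc zero_le_one]
    exact ⟨hu.1 x, hu.2 x⟩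
  have hsub : Set.univ.pi (fun _ : X => ({0, 1} : Set ℝ)) ⊆ Set.Icc 0 1 := by
    intro v hv
    constructor <;> intro x <;> rcases hv x trivial with h | h <;> rw [h] <;> simp
  obtain ⟨v, hv, huv⟩ := (hf.subset (convexHull_min hsub (convex_Icc 0 1))
    (convex_convexHull ℝ _)).exists_ge_of_mem_convexHull (subset_convexHull ℝ _) hmem
  exact huv.trans (h v fun x => hv x trivial)

/-- The mean gap of the two masses that an output column `1 + δ u` receives, where `a` and `b` are
the integrals of `u` under the two input distributions. -/
noncomputable def columnGap (l δ a b : ℝ) : ℝ := meanGap l (1 + δ * a) (1 + δ * b)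

lemma columnGap_swap (l δ a b : ℝ) : columnGap (1 - l) δ b a = columnGap l δ a b :=
  meanGap_swap _ _ _

lemma columnGap_convex {l δ : ℝ} (h0 : 0 ≤ l) (h1 : l ≤ 1) (hδ : 0 ≤ δ) {s t a b a' b' : ℝ}
    (hs : 0 ≤ s) (ht : 0 ≤ t) (hst : s + t = 1) (ha : 0 ≤ a) (hb : 0 ≤ b) (ha' : 0 ≤ a')
    (hb' : 0 ≤ b') :
    columnGap l δ (s * a + t * a') (s * b + t * b') ≤
      s * columnGap l δ a b + t * columnGap l δ a' b' := by
  have h := meanGap_convex h0 h1 hs ht hst (p := 1 + δ * a) (q := 1 + δ * b) (p' := 1 + δ * a')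
    (q' := 1 + δ * b') (by positivity) (by positivity) (by positivity) (by positivity)
  unfold columnGap
  convert h using 2
  · linear_combination -hst
  · linear_combination -hst

lemma le_columnGap {l δ a b : ℝ} (h0 : 0 ≤ l) (h1 : l ≤ 1) (hδ : 0 ≤ δ) (ha : 0 ≤ a) (ha1 : a ≤ 1)
    (hb : 0 ≤ b) (hb1 : b ≤ 1) :
    (1 - 2 * δ) * (l * (1 - l) / 2 * δ ^ 2 * (a - b) ^ 2) ≤ columnGap l δ a b := by
  refine le_trans (le_of_eq ?_) (le_meanGap (δ := δ) h0 h1 ?_ ?_ ?_ ?_)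
  · ring
  all_goals nlinarith

lemma columnGap_le {l δ a b : ℝ} (h0 : 0 ≤ l) (h1 : l ≤ 1) (hδ : 0 ≤ δ) (ha : 0 ≤ a) (ha1 : a ≤ 1)
    (hb : 0 ≤ b) (hb1 : b ≤ 1) :
    columnGap l δ a b ≤ (1 + δ) * (l * (1 - l) / 2 * δ ^ 2 * (a - b) ^ 2) := by
  refine le_trans (meanGap_le (δ := δ) h0 h1 ?_ ?_ ?_ ?_) (le_of_eq ?_)
  on_goal 5 => ring
  all_goals nlinarith

/-- A column whose masses differ by less than the total variation `D` is strictly worse than the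
extremal ones, with enough room to absorb the third order terms. -/
lemma le_certificate_of_gap {K D γ δ G₁ G₂ G₃ G M α β σ : ℝ} (hK : 0 ≤ K) (hδ : 0 ≤ δ)
    (hγ : 16 * δ ≤ γ) (hγD : γ ≤ D) (hD : D ≤ 1)
    (h₁ : (1 - 2 * δ) * (K * D ^ 2) ≤ G₁) (h₁' : G₁ ≤ (1 + δ) * (K * D ^ 2))
    (h₂ : (1 - 2 * δ) * (K * D ^ 2) ≤ G₂) (h₂' : G₂ ≤ (1 + δ) * (K * D ^ 2))
    (h₃ : (1 - 2 * δ) * (K * D ^ 2) ≤ G₃) (h₃' : G₃ ≤ (1 + δ) * (K * D ^ 2))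
    (hM : (2 + δ) * M = G₁ + G₂) (hG : G ≤ (1 + δ) * (K * (D - γ) ^ 2))
    (hα : α ∈ Set.Icc (0 : ℝ) 1) (hβ : β ∈ Set.Icc (0 : ℝ) 1) (hσ : σ ∈ Set.Icc (0 : ℝ) 1) :
    G ≤ M + ((G₁ - M) * α + (G₂ - M - (G₃ - G₁)) * β + (G₃ - G₁) * σ) := by
  have hD0 : 0 ≤ D := by linarith
  have hE : 0 ≤ K * D ^ 2 := by positivity
  set E := K * D ^ 2
  have hδE : 0 ≤ δ * E := by positivity
  have hδδE : 0 ≤ δ * (δ * E) := by positivity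
  have hM1 : (1 - 3 * δ) * E ≤ M := by
    refine le_of_mul_le_mul_left (a := 2 + δ) ?_ (by linarith)
    rw [hM]
    nlinarith
  have hM2 : M ≤ (1 + δ) * E := by
    refine le_of_mul_le_mul_left (a := 2 + δ) ?_ (by linarith)
    rw [hM]
    nlinarith
  have low : ∀ {m c θ : ℝ}, 0 ≤ c → -c ≤ m → θ ∈ Set.Icc (0 : ℝ) 1 → -c ≤ m * θ := by
    intro m c θ hc hm hθ
    nlinarith [mul_le_mul_of_nonneg_right hm hθ.1, mul_le_mul_of_nonneg_left hθ.2 hc]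
  have lα := low (m := G₁ - M) (c := 3 * (δ * E)) (by linarith) (by linarith) hα
  have lβ := low (m := G₂ - M - (G₃ - G₁)) (c := 6 * (δ * E)) (by linarith) (by linarith) hβ
  have lσ := low (m := G₃ - G₁) (c := 3 * (δ * E)) (by linarith) (by linarith) hσ
  -- `M` is at least `(1 - 3δ)E` and the three corrections cost at most `3δE`, `6δE`, `3δE`, so the
  -- target is at least `(1 - 15δ)E`. Since `D ≤ 1`, the assumption `16δ ≤ γ` pays for these losses
  -- and for the factor `1 + δ`.
  have hfin : (1 + δ) * (D - γ) ^ 2 ≤ (1 - 15 * δ) * D ^ 2 := by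
    have hγ0 : 0 ≤ γ := by linarith
    have e1 : (D - γ) ^ 2 ≤ D ^ 2 - γ * D := by nlinarith
    have e2 : 16 * δ * D ^ 2 ≤ γ * D := by
      calc 16 * δ * D ^ 2 ≤ γ * D ^ 2 := by gcongr
        _ ≤ γ * D := by nlinarith [mul_nonneg hγ0 hD0]
    nlinarith [mul_le_mul_of_nonneg_left e1 (by linarith : 0 ≤ 1 + δ),
      mul_nonneg hδ (mul_nonneg hγ0 hD0)]
  have := mul_le_mul_of_nonneg_left hfin hK
  nlinarith

/-! ### Strict regions, ties and the total variation gap -/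

/-- The indicator function of `{x | Q x < P x}`. -/
noncomputable def above {X : Type*} (P Q : X → ℝ) (x : X) : ℝ := if Q x < P x then 1 else 0

/-- The indicator function of `{x | P x = Q x}`. -/
noncomputable def tie {X : Type*} (P Q : X → ℝ) (x : X) : ℝ := if P x = Q x then 1 else 0

lemma tie_comm {X : Type*} (P Q : X → ℝ) : tie Q P = tie P Q := by
  ext x
  simp [tie, eq_comm]

lemma above_add_above_add_tie {X : Type*} (P Q : X → ℝ) (x : X) :
    above P Q x + above Q P x + tie P Q x = 1 := by
  rcases lt_trichotomy (P x) (Q x) with h | h | h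
  · simp [above, tie, h, h.not_gt, h.ne]
  · simp [above, tie, h]
  · simp [above, tie, h, h.not_gt, h.ne']

lemma dotProduct_tie {X : Type*} [Fintype X] (P Q : X → ℝ) : Q ⬝ᵥ tie P Q = P ⬝ᵥ tie P Q := by
  refine Finset.sum_congr rfl fun x _ => ?_
  unfold tie
  split_ifs with h <;> simp [h]

lemma dotProduct_mem_Icc {X : Type*} [Fintype X] {P u : X → ℝ} (hP : P ∈ stdSimplex ℝ X)
    (hu : u ∈ Set.Icc 0 1) : P ⬝ᵥ u ∈ Set.Icc (0 : ℝ) 1 := by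
  refine ⟨Finset.sum_nonneg fun x _ => mul_nonneg (hP.1 x) (hu.1 x), ?_⟩
  rw [← hP.2]
  exact Finset.sum_le_sum fun x _ => mul_le_of_le_one_right (hP.1 x) (hu.2 x)

/-- `above P Q` maximizes `P ⬝ᵥ v - Q ⬝ᵥ v` pointwise. A single symbol off the tie set with the
wrong bit costs `|P x - Q x| ≥ γ`, and no other symbol can compensate. -/
lemma sub_dotProduct_le {X : Type*} [Fintype X] {P Q : X → ℝ} {γ : ℝ}
    (hsep : ∀ x, P x ≠ Q x → γ ≤ |P x - Q x|) {v : X → ℝ} (hv : ∀ x, v x = 0 ∨ v x = 1)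
    (hx : ¬ ∀ x, (Q x < P x → v x = 1) ∧ (P x < Q x → v x = 0)) :
    P ⬝ᵥ v - Q ⬝ᵥ v ≤ P ⬝ᵥ above P Q - Q ⬝ᵥ above P Q - γ := by
  have hnn : ∀ x ∈ Finset.univ, 0 ≤ (P x - Q x) * (above P Q x - v x) := by
    intro x _
    unfold above
    split_ifs with h <;> rcases hv x with h' | h' <;> rw [h'] <;> nlinarith
  push Not at hx
  obtain ⟨x, hx⟩ := hx
  have hγ : γ ≤ (P x - Q x) * (above P Q x - v x) := by
    by_cases h : Q x < P x
    · have h0 : v x = 0 := by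
        rcases hv x with h' | h'
        · exact h'
        · exact absurd (hx fun _ => h').1 h.not_gt
      have := hsep x h.ne'
      rw [abs_of_pos (by linarith)] at this
      simpa [above, h, h0] using this
    · obtain ⟨h2, h3⟩ := hx fun h' => absurd h' h
      have h1 : v x = 1 := (hv x).resolve_left h3
      have := hsep x h2.ne
      rw [abs_of_neg (by linarith)] at this
      simp only [above, h, h1, if_false]
      linarith
  have h := hγ.trans (Finset.single_le_sum hnn (Finset.mem_univ x))
  have e : ∑ x, (P x - Q x) * (above P Q x - v x) =
      (P ⬝ᵥ above P Q - Q ⬝ᵥ above P Q) - (P ⬝ᵥ v - Q ⬝ᵥ v) := by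
    simp only [dotProduct, ← Finset.sum_sub_distrib]
    exact Finset.sum_congr rfl fun x _ => by ring
  linarith

lemma above_mem_Icc {X : Type*} (P Q : X → ℝ) : above P Q ∈ Set.Icc 0 1 := by
  constructor <;> intro x <;> simp only [above] <;> split_ifs <;> simp

lemma tie_mem_Icc {X : Type*} (P Q : X → ℝ) : tie P Q ∈ Set.Icc 0 1 := by
  constructor <;> intro x <;> simp only [tie] <;> split_ifs <;> simp

/-! ### The dual certificate -/

/-- Optimality of the randomized response on the partition `{Q < P}`, `{P ≤ Q}` in the linear
program over private channels, by weak duality: if this partition beats `{Q ≤ P}`, `{P < Q}`, then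
some linear functional dominates the mean gap of every column, with equality of the totals. -/
lemma exists_certificate {X : Type*} [Fintype X] {P Q : X → ℝ} (hP : P ∈ stdSimplex ℝ X)
    (hQ : Q ∈ stdSimplex ℝ X) {γ δ l : ℝ} (hsep : ∀ x, P x ≠ Q x → γ ≤ |P x - Q x|)
    (hδ : 0 ≤ δ) (hγ : 16 * δ ≤ γ) (h0 : 0 ≤ l) (h1 : l ≤ 1)
    (H : columnGap l δ (P ⬝ᵥ above P Q + P ⬝ᵥ tie P Q) (Q ⬝ᵥ above P Q + P ⬝ᵥ tie P Q) +
        columnGap l δ (P ⬝ᵥ above Q P) (Q ⬝ᵥ above Q P) ≤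
      columnGap l δ (P ⬝ᵥ above P Q) (Q ⬝ᵥ above P Q) +
        columnGap l δ (P ⬝ᵥ above Q P + P ⬝ᵥ tie P Q) (Q ⬝ᵥ above Q P + P ⬝ᵥ tie P Q)) :
    ∃ n : X → ℝ,
      (2 + δ) * ∑ x, n x = columnGap l δ (P ⬝ᵥ above P Q) (Q ⬝ᵥ above P Q) +
        columnGap l δ (P ⬝ᵥ above Q P + P ⬝ᵥ tie P Q) (Q ⬝ᵥ above Q P + P ⬝ᵥ tie P Q) ∧
      ∀ u ∈ Set.Icc (0 : X → ℝ) 1,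
        columnGap l δ (P ⬝ᵥ u) (Q ⬝ᵥ u) ≤ ∑ x, n x * (1 + δ * u x) := by
  have hPm := dotProduct_mem_Icc hP (above_mem_Icc P Q)
  have hQm := dotProduct_mem_Icc hQ (above_mem_Icc P Q)
  have hPm' := dotProduct_mem_Icc hP (above_mem_Icc Q P)
  have hQm' := dotProduct_mem_Icc hQ (above_mem_Icc Q P)
  have htm := dotProduct_mem_Icc hP (tie_mem_Icc P Q)
  have htQ := dotProduct_tie P Q
  have split : ∀ R : X → ℝ, ∑ x, R x = R ⬝ᵥ above P Q + R ⬝ᵥ above Q P + R ⬝ᵥ tie P Q := by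
    intro R
    simp only [dotProduct, ← Finset.sum_add_distrib, ← mul_add, above_add_above_add_tie, mul_one]
  have sP := (split P).symm.trans hP.2
  have sQ := (split Q).symm.trans hQ.2
  rw [htQ] at sQ
  have hDD : Q ⬝ᵥ above Q P - P ⬝ᵥ above Q P = P ⬝ᵥ above P Q - Q ⬝ᵥ above P Q := by linarith
  have degenerate : (∀ u ∈ Set.Icc (0 : X → ℝ) 1, columnGap l δ (P ⬝ᵥ u) (Q ⬝ᵥ u) = 0) →
      columnGap l δ (P ⬝ᵥ above P Q) (Q ⬝ᵥ above P Q) +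
        columnGap l δ (P ⬝ᵥ above Q P + P ⬝ᵥ tie P Q) (Q ⬝ᵥ above Q P + P ⬝ᵥ tie P Q) = 0 := by
    intro h
    have e := h (above Q P + tie P Q) (by
      constructor <;> intro x <;> simp only [above, tie, Pi.add_apply, Pi.zero_apply, Pi.one_apply]
        <;> split_ifs <;> linarith)
    rw [dotProduct_add, dotProduct_add, htQ] at e
    rw [h _ (above_mem_Icc P Q), e, add_zero]
  -- The cases `δ = 0` and `P = Q` are split off because the construction divides by `δ` and by `D`.
  -- All gaps vanish there, so the zero functional suffices.
  rcases hδ.eq_or_lt with rfl | hδ'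
  · have hz : ∀ a b, columnGap l 0 a b = 0 := by
      intro a b
      simp only [columnGap, zero_mul, add_zero]
      exact meanGap_self zero_le_one
    exact ⟨0, by simp [hz], by simp [hz]⟩
  by_cases hPQ : P = Q
  · have hz : ∀ u ∈ Set.Icc (0 : X → ℝ) 1, columnGap l δ (P ⬝ᵥ u) (Q ⬝ᵥ u) = 0 := by
      intro u hu
      have := (dotProduct_mem_Icc hP hu).1
      rw [← hPQ]
      exact meanGap_self (by positivity)
    refine ⟨0, by simp [degenerate hz], fun u hu => ?_⟩
    simp [hz u hu]
  set D := P ⬝ᵥ above P Q - Q ⬝ᵥ above P Q with hD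
  have hγD : γ ≤ D := by
    by_contra hlt
    -- The zero vector misses every symbol with `Q x < P x`, so one such symbol forces `γ ≤ D`; the
    -- exchanged version treats `P x < Q x`.
    have key := sub_dotProduct_le hsep (v := 0) (by simp)
    have key' := sub_dotProduct_le (P := Q) (Q := P)
      (fun x hx => abs_sub_comm (P x) (Q x) ▸ hsep x hx.symm) (v := 0) (by simp)
    simp only [dotProduct_zero, sub_zero, Pi.zero_apply] at key key'
    apply hPQ
    ext x
    apply le_antisymm <;> refine not_lt.1 fun hx => hlt ?_
    · have := key fun h => zero_ne_one ((h x).1 hx)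
      linarith
    · have := key' fun h => zero_ne_one ((h x).1 hx)
      linarith
  have hD0 : 0 < D := by linarith
  have hD1 : D ≤ 1 := by linarith [hPm.2, hQm.1]
  set t := P ⬝ᵥ tie P Q with ht
  set G₁ := columnGap l δ (P ⬝ᵥ above P Q) (Q ⬝ᵥ above P Q) with hG₁
  set G₂ := columnGap l δ (P ⬝ᵥ above Q P + t) (Q ⬝ᵥ above Q P + t) with hG₂
  set G₃ := columnGap l δ (P ⬝ᵥ above P Q + t) (Q ⬝ᵥ above P Q + t) with hG₃
  set G₄ := columnGap l δ (P ⬝ᵥ above Q P) (Q ⬝ᵥ above Q P)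
  set K := l * (1 - l) / 2 * δ ^ 2
  have hK : 0 ≤ K := by
    have := sub_nonneg.2 h1
    positivity
  -- `M` is the dual value: randomized response on the partition uses two columns, each with weight
  -- `1 / (2 + δ)`.
  set M := (G₁ + G₂) / (2 + δ) with hMdef
  have hM : (2 + δ) * M = G₁ + G₂ := by
    rw [hMdef]
    field_simp
  set α : (X → ℝ) → ℝ := fun v => (∑ x, above P Q x * (P x - Q x) * v x) / D with hα
  set β : (X → ℝ) → ℝ := fun v => (∑ x, above Q P x * (Q x - P x) * v x) / D with hβ
  set σ : (X → ℝ) → ℝ := fun v => (∑ x, tie P Q x * P x * v x) / t with hσ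
  -- The slope of the affine functional `M + ∑ x, m x * v x`. When `t ≠ 0`, `α`, `β`, `σ` measure
  -- the shares of `{Q < P}`, `{P < Q}` and the ties contained in `v`. The coefficients make the
  -- functional `G₁` on `{Q < P}` and `G₂` on its complement, and let the ties contribute `G₃ - G₁`.
  set m : X → ℝ := fun x => (G₁ - M) * (above P Q x * (P x - Q x) / D) +
    (G₂ - M - (G₃ - G₁)) * (above Q P x * (Q x - P x) / D) +
    (G₃ - G₁) * (tie P Q x * P x / t) with hm
  have hmv : ∀ v : X → ℝ, ∑ x, m x * v x =
      (G₁ - M) * α v + (G₂ - M - (G₃ - G₁)) * β v + (G₃ - G₁) * σ v := by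
    intro v
    simp only [hα, hβ, hσ, Finset.mul_sum, Finset.sum_div, ← Finset.sum_add_distrib, hm]
    exact Finset.sum_congr rfl fun x _ => by ring
  have hα1 : α 1 = 1 := by
    rw [← div_self hD0.ne']
    simp only [hα, hD, dotProduct, ← Finset.sum_sub_distrib, Pi.one_apply]
    congr 1
    exact Finset.sum_congr rfl fun x _ => by ring
  have hβ1 : β 1 = 1 := by
    rw [← div_self hD0.ne']
    simp only [hβ, ← hDD, dotProduct, ← Finset.sum_sub_distrib, Pi.one_apply]
    congr 1
    exact Finset.sum_congr rfl fun x _ => by ring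
  have ht1 : ∑ x, tie P Q x * P x * (1 : X → ℝ) x = t := by
    simp only [ht, dotProduct, Pi.one_apply, mul_one]
    exact Finset.sum_congr rfl fun x _ => by ring
  -- If the ties have no mass, `σ` is zero by division by zero, but then `G₃ = G₁` and its
  -- coefficient vanishes.
  have hσ1 : (G₃ - G₁) * σ 1 = G₃ - G₁ := by
    by_cases h : t = 0
    · simp [hG₃, hG₁, h]
    · simp only [hσ, ht1, div_self h, mul_one]
  have hmono : ∀ w : X → ℝ, (∀ x, 0 ≤ w x) → ∀ v ∈ Set.Icc (0 : X → ℝ) 1,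
      ∑ x, w x * v x ∈ Set.Icc 0 (∑ x, w x * (1 : X → ℝ) x) := by
    intro w hw v hv
    exact ⟨Finset.sum_nonneg fun x _ => mul_nonneg (hw x) (hv.1 x),
      Finset.sum_le_sum fun x _ => mul_le_mul_of_nonneg_left (hv.2 x) (hw x)⟩
  have hαm : ∀ v ∈ Set.Icc (0 : X → ℝ) 1, α v ∈ Set.Icc (0 : ℝ) 1 := by
    intro v hv
    have h := hmono (fun x => above P Q x * (P x - Q x)) (fun x => by
      unfold above
      split_ifs with h
      · linarith
      · simp) v hv
    exact ⟨div_nonneg h.1 hD0.le, hα1 ▸ div_le_div_of_nonneg_right h.2 hD0.le⟩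
  have hβm : ∀ v ∈ Set.Icc (0 : X → ℝ) 1, β v ∈ Set.Icc (0 : ℝ) 1 := by
    intro v hv
    have h := hmono (fun x => above Q P x * (Q x - P x)) (fun x => by
      unfold above
      split_ifs with h
      · linarith
      · simp) v hv
    exact ⟨div_nonneg h.1 hD0.le, hβ1 ▸ div_le_div_of_nonneg_right h.2 hD0.le⟩
  have htie := hmono (fun x => tie P Q x * P x) (fun x => mul_nonneg ((tie_mem_Icc P Q).1 x) (hP.1 x))
  simp only [ht1] at htie
  have hσm : ∀ v ∈ Set.Icc (0 : X → ℝ) 1, σ v ∈ Set.Icc (0 : ℝ) 1 := fun v hv =>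
    ⟨div_nonneg (htie v hv).1 htm.1, div_le_one_of_le₀ (htie v hv).2 htm.1⟩
  have hσt : ∀ v ∈ Set.Icc (0 : X → ℝ) 1, σ v * t = ∑ x, tie P Q x * P x * v x := by
    intro v hv
    by_cases h : t = 0
    · have := htie v hv
      rw [h] at this ⊢
      rw [mul_zero]
      exact le_antisymm this.1 this.2
    · exact div_mul_cancel₀ _ h
  have htieQ : ∀ v : X → ℝ, ∑ x, tie P Q x * Q x * v x = ∑ x, tie P Q x * P x * v x := by
    intro v
    refine Finset.sum_congr rfl fun x _ => ?_
    unfold tie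
    split_ifs with h <;> simp [h]
  -- The coefficients add up to `G₁ + G₂ - 2M`. This equality makes `n = m / δ` have total `M` and
  -- turns `∑ x, n x * (1 + δ * u x)` into the affine functional.
  have hsum : ∑ x, m x = δ * M := by
    have := hmv 1
    simp only [Pi.one_apply, mul_one] at this
    rw [this, hα1, hβ1, hσ1]
    linarith
  have bounds : ∀ {a b : ℝ}, a ∈ Set.Icc (0 : ℝ) 1 → b ∈ Set.Icc (0 : ℝ) 1 → |a - b| = D →
      (1 - 2 * δ) * (K * D ^ 2) ≤ columnGap l δ a b ∧
        columnGap l δ a b ≤ (1 + δ) * (K * D ^ 2) := by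
    intro a b ha hb hab
    rw [← hab, sq_abs]
    exact ⟨le_columnGap h0 h1 hδ ha.1 ha.2 hb.1 hb.2, columnGap_le h0 h1 hδ ha.1 ha.2 hb.1 hb.2⟩
  have b₁ := bounds hPm hQm (by rw [← hD, abs_of_pos hD0])
  have b₂ := bounds (a := P ⬝ᵥ above Q P + t) (b := Q ⬝ᵥ above Q P + t)
    ⟨by linarith [hPm'.1, htm.1], by linarith [hPm.1]⟩
    ⟨by linarith [hQm'.1, htm.1], by linarith [hQm.1]⟩
    (by rw [add_sub_add_right_eq_sub, abs_sub_comm, hDD, abs_of_pos hD0])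
  have b₃ := bounds (a := P ⬝ᵥ above P Q + t) (b := Q ⬝ᵥ above P Q + t)
    ⟨by linarith [hPm.1, htm.1], by linarith [hPm'.1]⟩
    ⟨by linarith [hQm.1, htm.1], by linarith [hQm'.1]⟩
    (by rw [add_sub_add_right_eq_sub, ← hD, abs_of_pos hD0])
  have vertex : ∀ v : X → ℝ, (∀ x, v x = 0 ∨ v x = 1) →
      columnGap l δ (P ⬝ᵥ v) (Q ⬝ᵥ v) - ∑ x, m x * v x ≤ M := by
    intro v hv
    have hvm : v ∈ Set.Icc (0 : X → ℝ) 1 := by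
      constructor <;> intro x <;> rcases hv x with h | h <;> simp [h]
    have hσ' := hσm v hvm
    rw [hmv, sub_le_iff_le_add]
    -- Sets between `{Q < P}` and `{Q ≤ P}`: the masses interpolate with parameter `σ v`, and the
    -- functional equals the chord from `G₁` to `G₃`, so convexity suffices.
    by_cases c₁ : ∀ x, (Q x < P x → v x = 1) ∧ (P x < Q x → v x = 0)
    · have hmul : ∀ x, above P Q x * v x = above P Q x ∧ above Q P x * v x = 0 := by
        intro x
        constructor <;> unfold above <;> split_ifs with h <;> simp [(c₁ x).1, (c₁ x).2, h]
      have eα : α v = 1 := by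
        rw [← hα1]
        simp only [hα, mul_right_comm, hmul, Pi.one_apply, mul_one]
      have eβ : β v = 0 := by
        simp only [hβ, mul_right_comm, hmul, zero_mul, Finset.sum_const_zero, zero_div]
      have dec : ∀ R : X → ℝ, R ⬝ᵥ v = R ⬝ᵥ above P Q + ∑ x, tie P Q x * R x * v x := by
        intro R
        simp only [dotProduct, ← Finset.sum_add_distrib]
        refine Finset.sum_congr rfl fun x _ => ?_
        have := above_add_above_add_tie P Q x
        have h := hmul x
        linear_combination (-R x * v x) * this + R x * h.1 + R x * h.2
      have hc := columnGap_convex h0 h1 hδ (sub_nonneg.2 hσ'.2) hσ'.1 (by ring) hPm.1 hQm.1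
        (add_nonneg hPm.1 htm.1) (add_nonneg hQm.1 htm.1)
      rw [dec P, dec Q, htieQ, ← hσt v hvm, eα, eβ]
      rw [show (1 - σ v) * P ⬝ᵥ above P Q + σ v * (P ⬝ᵥ above P Q + t) =
        P ⬝ᵥ above P Q + σ v * t by ring, show (1 - σ v) * Q ⬝ᵥ above P Q +
        σ v * (Q ⬝ᵥ above P Q + t) = Q ⬝ᵥ above P Q + σ v * t by ring] at hc
      linarith
    -- Sets between `{P < Q}` and `{P ≤ Q}`: the chord now runs from `G₄` to `G₂`, while the
    -- functional runs from `G₂ - (G₃ - G₁)` to `G₂`. The hypothesis `H` is exactly that the former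
    -- starts no higher.
    by_cases c₂ : ∀ x, (P x < Q x → v x = 1) ∧ (Q x < P x → v x = 0)
    · have hmul : ∀ x, above Q P x * v x = above Q P x ∧ above P Q x * v x = 0 := by
        intro x
        constructor <;> unfold above <;> split_ifs with h <;> simp [(c₂ x).1, (c₂ x).2, h]
      have eβ : β v = 1 := by
        rw [← hβ1]
        simp only [hβ, mul_right_comm, hmul, Pi.one_apply, mul_one]
      have eα : α v = 0 := by
        simp only [hα, mul_right_comm, hmul, zero_mul, Finset.sum_const_zero, zero_div]
      have dec : ∀ R : X → ℝ, R ⬝ᵥ v = R ⬝ᵥ above Q P + ∑ x, tie P Q x * R x * v x := by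
        intro R
        simp only [dotProduct, ← Finset.sum_add_distrib]
        refine Finset.sum_congr rfl fun x _ => ?_
        have := above_add_above_add_tie P Q x
        have h := hmul x
        linear_combination (-R x * v x) * this + R x * h.1 + R x * h.2
      have hc := columnGap_convex h0 h1 hδ (sub_nonneg.2 hσ'.2) hσ'.1 (by ring) hPm'.1 hQm'.1
        (add_nonneg hPm'.1 htm.1) (add_nonneg hQm'.1 htm.1)
      rw [dec P, dec Q, htieQ, ← hσt v hvm, eα, eβ]
      rw [show (1 - σ v) * P ⬝ᵥ above Q P + σ v * (P ⬝ᵥ above Q P + t) =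
        P ⬝ᵥ above Q P + σ v * t by ring, show (1 - σ v) * Q ⬝ᵥ above Q P +
        σ v * (Q ⬝ᵥ above Q P + t) = Q ⬝ᵥ above Q P + σ v * t by ring] at hc
      have := mul_nonneg (sub_nonneg.2 hσ'.2) (sub_nonneg.2 H)
      linarith
    -- All remaining sets miss both extremal families, so their mass difference is at most `D - γ`
    -- in absolute value.
    · have k₁ := sub_dotProduct_le hsep hv c₁
      have k₂ := sub_dotProduct_le (P := Q) (Q := P)
        (fun x hx => abs_sub_comm (P x) (Q x) ▸ hsep x hx.symm) hv c₂
      rw [hDD] at k₂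
      have hab : |P ⬝ᵥ v - Q ⬝ᵥ v| ≤ D - γ := abs_le.2 ⟨by linarith, by linarith⟩
      have hPv := dotProduct_mem_Icc hP hvm
      have hQv := dotProduct_mem_Icc hQ hvm
      refine le_certificate_of_gap hK hδ hγ hγD hD1 b₁.1 b₁.2 b₂.1 b₂.2 b₃.1 b₃.2 hM ?_
        (hαm v hvm) (hβm v hvm) hσ'
      refine (columnGap_le h0 h1 hδ hPv.1 hPv.2 hQv.1 hQv.2).trans ?_
      have := pow_le_pow_left₀ (abs_nonneg _) hab 2
      rw [sq_abs] at this
      gcongr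
  have hsn : ∑ x, m x / δ = M := by
    rw [← Finset.sum_div, hsum, mul_div_cancel_left₀ _ hδ'.ne']
  refine ⟨fun x => m x / δ, by rw [hsn, hM], fun u hu => ?_⟩
  have hn : ∑ x, m x / δ * (1 + δ * u x) = M + ∑ x, m x * u x := by
    rw [← hsn, ← Finset.sum_add_distrib]
    refine Finset.sum_congr rfl fun x _ => ?_
    field_simp
  rw [hn, ← sub_le_iff_le_add]
  refine le_of_convexOn_of_vertices
    (f := fun u : X → ℝ => columnGap l δ (P ⬝ᵥ u) (Q ⬝ᵥ u) - ∑ x, m x * u x)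
    ⟨convex_Icc 0 1, fun u hu w hw a b ha hb hab => ?_⟩ vertex hu
  have hc := columnGap_convex h0 h1 hδ ha hb hab (dotProduct_mem_Icc hP hu).1
    (dotProduct_mem_Icc hQ hu).1 (dotProduct_mem_Icc hP hw).1 (dotProduct_mem_Icc hQ hw).1
  have hlin : ∑ x, m x * (a • u + b • w) x = a * ∑ x, m x * u x + b * ∑ x, m x * w x := by
    simp only [Finset.mul_sum, ← Finset.sum_add_distrib, Pi.add_apply, Pi.smul_apply, smul_eq_mul]
    exact Finset.sum_congr rfl fun x _ => by ring
  simp only [dotProduct_add, dotProduct_smul, smul_eq_mul] at hlin ⊢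
  linarith

/-! ### Private channels as weighted columns, and weak duality -/

lemma sum_induced {X Y : Type*} [Fintype X] [Fintype Y] {P : X → ℝ} (hP : P ∈ stdSimplex ℝ X)
    {W : X → Y → ℝ} (hW : IsChannel W) : ∑ y, induced P W y = 1 := by
  unfold induced
  rw [Finset.sum_comm, ← hP.2]
  refine Finset.sum_congr rfl fun x _ => ?_
  rw [← Finset.mul_sum, (hW x).2, mul_one]

lemma sum_rpow_induced {X Y : Type*} [Fintype X] [Fintype Y] {P Q : X → ℝ}
    (hP : P ∈ stdSimplex ℝ X) (hQ : Q ∈ stdSimplex ℝ X) {W : X → Y → ℝ} (hW : IsChannel W)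
    (l : ℝ) : ∑ y, induced P W y ^ l * induced Q W y ^ (1 - l) =
      1 - ∑ y, meanGap l (induced P W y) (induced Q W y) := by
  simp only [meanGap, Finset.sum_sub_distrib, Finset.sum_add_distrib, ← Finset.mul_sum,
    sum_induced hP hW, sum_induced hQ hW]
  ring

/-- The weight `θ` is the least entry of the column, and privacy on the singleton `{y}` bounds all
other entries by `exp ε * θ`. If `θ = 0` the column vanishes, and if `exp ε = 1` it is constant;
then `u = 0` serves. -/
lemma IsLDP.exists_column {X Y : Type*} [Finite X] [Nonempty X] [Fintype Y] {ε : ℝ}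
    {W : X → Y → ℝ} (hW : IsLDP ε W) (y : Y) :
    ∃ θ : ℝ, 0 ≤ θ ∧ ∃ u ∈ Set.Icc (0 : X → ℝ) 1,
      ∀ x, W x y = θ * (1 + (Real.exp ε - 1) * u x) := by
  obtain ⟨x₀, hmin⟩ := Finite.exists_min fun x => W x y
  have hle : ∀ x, W x y ≤ Real.exp ε * W x₀ y := fun x => by simpa using hW.2 x x₀ {y}
  have hθ : 0 ≤ W x₀ y := (hW.1 x₀).1 y
  refine ⟨W x₀ y, hθ, ?_⟩
  rcases hθ.eq_or_lt with h | hθ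
  · refine ⟨0, by simp, fun x => ?_⟩
    have h₁ := hle x
    have h₂ := hmin x
    rw [← h] at h₁ h₂ ⊢
    linarith
  have hδ : 0 ≤ Real.exp ε - 1 := by
    refine nonneg_of_mul_nonneg_left ?_ hθ
    linarith [hle x₀]
  rcases hδ.eq_or_lt with h | hδ
  · refine ⟨0, by simp, fun x => ?_⟩
    have h₁ := hle x
    have h₂ := hmin x
    rw [show Real.exp ε = 1 by linarith] at h₁ ⊢
    linarith
  refine ⟨fun x => (W x y / W x₀ y - 1) / (Real.exp ε - 1), ⟨fun x => ?_, fun x => ?_⟩,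
    fun x => ?_⟩
  · exact div_nonneg (sub_nonneg.2 ((one_le_div hθ).2 (hmin x))) hδ.le
  · exact div_le_one_of_le₀ (sub_le_sub_right ((div_le_iff₀ hθ).2 (hle x)) 1) hδ.le
  · field_simp
    ring

/-- Weak duality: by homogeneity the certificate bounds the gap of each column, and summing over
outputs leaves `∑ x, n x` because each row of `W` has total one. -/
lemma one_sub_sum_certificate_le {X Y : Type*} [Fintype X] [Fintype Y] {P Q : X → ℝ}
    (hP : P ∈ stdSimplex ℝ X) (hQ : Q ∈ stdSimplex ℝ X) {ε l : ℝ} (hε : 0 ≤ ε)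
    {W : X → Y → ℝ} (hW : IsLDP ε W) {n : X → ℝ}
    (hn : ∀ u ∈ Set.Icc (0 : X → ℝ) 1, columnGap l (Real.exp ε - 1) (P ⬝ᵥ u) (Q ⬝ᵥ u) ≤
      ∑ x, n x * (1 + (Real.exp ε - 1) * u x)) :
    1 - ∑ x, n x ≤ ∑ y, induced P W y ^ l * induced Q W y ^ (1 - l) := by
  have : Nonempty X := by
    by_contra h
    rw [not_nonempty_iff] at h
    simpa using hP.2
  have hδ : 0 ≤ Real.exp ε - 1 := sub_nonneg.2 (Real.one_le_exp hε)
  have column : ∀ y, meanGap l (induced P W y) (induced Q W y) ≤ ∑ x, n x * W x y := by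
    intro y
    obtain ⟨θ, hθ, u, hu, hWu⟩ := hW.exists_column y
    have ind : ∀ R ∈ stdSimplex ℝ X,
        induced R W y = θ * (1 + (Real.exp ε - 1) * R ⬝ᵥ u) := by
      intro R hR
      have h : induced R W y = θ * (∑ x, R x + (Real.exp ε - 1) * R ⬝ᵥ u) := by
        simp only [induced, hWu, dotProduct, Finset.mul_sum, ← Finset.sum_add_distrib]
        exact Finset.sum_congr rfl fun x _ => by ring
      rw [h, hR.2]
    have hPu := (dotProduct_mem_Icc hP hu).1
    have hQu := (dotProduct_mem_Icc hQ hu).1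
    rw [ind P hP, ind Q hQ, meanGap_mul hθ (by positivity) (by positivity)]
    refine (mul_le_mul_of_nonneg_left (hn u hu) hθ).trans (le_of_eq ?_)
    rw [Finset.mul_sum]
    refine Finset.sum_congr rfl fun x _ => ?_
    rw [hWu]
    ring
  have htotal : ∑ y, ∑ x, n x * W x y = ∑ x, n x := by
    rw [Finset.sum_comm]
    refine Finset.sum_congr rfl fun x _ => ?_
    rw [← Finset.mul_sum, (hW.1 x).2, mul_one]
  rw [sum_rpow_induced hP hQ hW.1, ← htotal]
  exact sub_le_sub_left (Finset.sum_le_sum fun y _ => column y) 1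

/-! ### The binary mechanism: privacy and affinity -/

lemma binaryMechanism_apply {X : Type*} (P₀ P₁ : X → ℝ) (τ ε : ℝ) (x : X) (y : Fin 2) :
    binaryMechanism P₀ P₁ τ ε x y = binaryRR ε (quantizer P₀ P₁ τ x) y := by
  simp [binaryMechanism, induced, quantizerChannel]

lemma isLDP_binaryMechanism {X : Type*} (P₀ P₁ : X → ℝ) (τ : ℝ) {ε : ℝ} (hε : 0 ≤ ε) :
    IsLDP ε (binaryMechanism P₀ P₁ τ ε) := by
  have he : 1 ≤ Real.exp ε := Real.one_le_exp hε
  have he0 : 0 < Real.exp ε := Real.exp_pos ε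
  refine ⟨fun x => ⟨fun y => ?_, ?_⟩, fun x x' S => ?_⟩
  · rw [binaryMechanism_apply]
    unfold binaryRR
    split_ifs <;> positivity
  · simp only [binaryMechanism_apply, Fin.sum_univ_two]
    generalize quantizer P₀ P₁ τ x = v
    fin_cases v <;> simp [binaryRR] <;> field_simp
    exact add_comm _ _
  · rw [Finset.mul_sum]
    refine Finset.sum_le_sum fun y _ => ?_
    have h₁ : binaryMechanism P₀ P₁ τ ε x y ≤ Real.exp ε / (Real.exp ε + 1) := by
      rw [binaryMechanism_apply]
      unfold binaryRR
      split_ifs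
      · exact le_rfl
      · gcongr
    have h₂ : 1 / (Real.exp ε + 1) ≤ binaryMechanism P₀ P₁ τ ε x' y := by
      rw [binaryMechanism_apply]
      unfold binaryRR
      split_ifs
      · gcongr
      · exact le_rfl
    calc _ ≤ Real.exp ε * (1 / (Real.exp ε + 1)) := by rwa [mul_one_div]
      _ ≤ _ := by gcongr

/-- The indicator function of the acceptance region `{x | P₀ x ≥ τ P₁ x}` of the quantizer. -/
noncomputable def accept {X : Type*} (P₀ P₁ : X → ℝ) (τ : ℝ) (x : X) : ℝ :=
  if P₀ x ≥ τ * P₁ x then 1 else 0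

lemma sum_rpow_induced_binaryMechanism {X : Type*} [Fintype X] {P₀ P₁ : X → ℝ}
    (hP₀ : P₀ ∈ stdSimplex ℝ X) (hP₁ : P₁ ∈ stdSimplex ℝ X) (τ l : ℝ) {ε a b : ℝ} (hε : 0 ≤ ε)
    (ha : P₀ ⬝ᵥ accept P₀ P₁ τ = a) (hb : P₁ ⬝ᵥ accept P₀ P₁ τ = b) :
    ∑ y, induced P₀ (binaryMechanism P₀ P₁ τ ε) y ^ l *
        induced P₁ (binaryMechanism P₀ P₁ τ ε) y ^ (1 - l) =
      1 - (columnGap l (Real.exp ε - 1) a b + columnGap l (Real.exp ε - 1) (1 - a) (1 - b)) /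
        (2 + (Real.exp ε - 1)) := by
  have he : 1 ≤ Real.exp ε := Real.one_le_exp hε
  have hδ : 0 ≤ Real.exp ε - 1 := by linarith
  have hmem : accept P₀ P₁ τ ∈ Set.Icc 0 1 := by
    constructor <;> intro x <;> simp only [accept] <;> split_ifs <;> simp
  have hc : 0 ≤ (2 + (Real.exp ε - 1))⁻¹ := by positivity
  have hW : ∀ x, binaryMechanism P₀ P₁ τ ε x 0 =
      (2 + (Real.exp ε - 1))⁻¹ * (1 + (Real.exp ε - 1) * accept P₀ P₁ τ x) ∧
      binaryMechanism P₀ P₁ τ ε x 1 =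
      (2 + (Real.exp ε - 1))⁻¹ * (1 + (Real.exp ε - 1) * (1 - accept P₀ P₁ τ x)) := by
    intro x
    simp only [binaryMechanism_apply, quantizer, accept, binaryRR]
    rw [show 2 + (Real.exp ε - 1) = Real.exp ε + 1 by ring]
    split_ifs <;> simp_all [div_eq_inv_mul]
  have ind : ∀ R ∈ stdSimplex ℝ X, induced R (binaryMechanism P₀ P₁ τ ε) 0 =
      (2 + (Real.exp ε - 1))⁻¹ * (1 + (Real.exp ε - 1) * R ⬝ᵥ accept P₀ P₁ τ) ∧
      induced R (binaryMechanism P₀ P₁ τ ε) 1 =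
      (2 + (Real.exp ε - 1))⁻¹ * (1 + (Real.exp ε - 1) * (1 - R ⬝ᵥ accept P₀ P₁ τ)) := by
    intro R hR
    have h : induced R (binaryMechanism P₀ P₁ τ ε) 0 = (2 + (Real.exp ε - 1))⁻¹ *
        (∑ x, R x + (Real.exp ε - 1) * R ⬝ᵥ accept P₀ P₁ τ) ∧
        induced R (binaryMechanism P₀ P₁ τ ε) 1 = (2 + (Real.exp ε - 1))⁻¹ *
        (∑ x, R x + (Real.exp ε - 1) * (∑ x, R x - R ⬝ᵥ accept P₀ P₁ τ)) := by
      simp only [induced, hW, dotProduct, Finset.mul_sum, ← Finset.sum_add_distrib,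
        ← Finset.sum_sub_distrib]
      constructor <;> exact Finset.sum_congr rfl fun x _ => by ring
    rwa [hR.2] at h
  have hm₀ := dotProduct_mem_Icc hP₀ hmem
  have hm₁ := dotProduct_mem_Icc hP₁ hmem
  rw [sum_rpow_induced hP₀ hP₁ (isLDP_binaryMechanism P₀ P₁ τ hε).1, Fin.sum_univ_two,
    (ind P₀ hP₀).1, (ind P₀ hP₀).2, (ind P₁ hP₁).1, (ind P₁ hP₁).2]
  rw [ha] at hm₀ ⊢
  rw [hb] at hm₁ ⊢
  have := sub_nonneg.2 hm₀.2
  have := sub_nonneg.2 hm₁.2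
  have := hm₀.1
  have := hm₁.1
  rw [meanGap_mul hc (by positivity) (by positivity),
    meanGap_mul hc (by positivity) (by positivity), ← mul_add, inv_mul_eq_div]
  rfl

/-! ### Comparison of arbitrary private mechanisms with two thresholds -/

lemma exists_pos_le_of_ne_zero {X : Type*} [Finite X] (f : X → ℝ) :
    ∃ γ : ℝ, 0 < γ ∧ ∀ x, f x ≠ 0 → γ ≤ |f x| := by
  rcases isEmpty_or_nonempty X
  · exact ⟨1, one_pos, isEmptyElim⟩
  -- The value `1` at the zeros of `f` keeps the minimum positive.
  obtain ⟨x₀, hmin⟩ := Finite.exists_min fun x => if f x = 0 then 1 else |f x|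
  refine ⟨if f x₀ = 0 then 1 else |f x₀|, ?_, fun x hx => by simpa [hx] using hmin x⟩
  split_ifs with h
  · exact one_pos
  · exact abs_pos.2 h

/-- For small privacy parameters one of two binary mechanisms, which differ in the bit that they
assign to the symbols of equal probability, minimizes the affinity `∑ y, Q₀(y) ^ l * Q₁(y) ^ (1 - l)`. -/
lemma exists_binaryMechanism_le {X : Type*} [Fintype X] {P₀ P₁ : X → ℝ}
    (hP₀ : P₀ ∈ stdSimplex ℝ X) (hP₁ : P₁ ∈ stdSimplex ℝ X) {γ : ℝ} (hγ : 0 < γ)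
    (hsep : ∀ x, P₀ x ≠ P₁ x → γ ≤ |P₀ x - P₁ x|) {ε : ℝ} (hε : 0 ≤ ε)
    (hεγ : 16 * (Real.exp ε - 1) ≤ γ) {Y : Type*} [Fintype Y] {W : X → Y → ℝ} (hW : IsLDP ε W)
    {l : ℝ} (h0 : 0 ≤ l) (h1 : l ≤ 1) :
    ∃ τ, (τ = 1 ∨ τ = 1 + γ) ∧
      ∑ y, induced P₀ (binaryMechanism P₀ P₁ τ ε) y ^ l *
          induced P₁ (binaryMechanism P₀ P₁ τ ε) y ^ (1 - l) ≤
        ∑ y, induced P₀ W y ^ l * induced P₁ W y ^ (1 - l) := by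
  have hδ : 0 ≤ Real.exp ε - 1 := sub_nonneg.2 (Real.one_le_exp hε)
  have split : ∀ R ∈ stdSimplex ℝ X,
      R ⬝ᵥ above P₀ P₁ + R ⬝ᵥ above P₁ P₀ + R ⬝ᵥ tie P₀ P₁ = 1 := by
    intro R hR
    rw [← hR.2]
    simp only [dotProduct, ← Finset.sum_add_distrib, ← mul_add, above_add_above_add_tie, mul_one]
  have s₀ := split P₀ hP₀
  have s₁ := split P₁ hP₁
  have ht := dotProduct_tie P₀ P₁
  rw [ht] at s₁
  have acc : accept P₀ P₁ 1 = above P₀ P₁ + tie P₀ P₁ := by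
    ext x
    rcases lt_trichotomy (P₀ x) (P₁ x) with h | h | h
    · simp [accept, above, tie, h, h.not_gt, h.ne]
    · simp [accept, above, tie, h]
    · simp [accept, above, tie, h, h.le, h.ne']
  -- Threshold `1 + γ` rejects ties of positive mass yet keeps all of `{P₁ < P₀}`, since `P₀ x ≥ P₁
  -- x + γ ≥ (1 + γ) * P₁ x` by `P₁ x ≤ 1`. Symbols of zero mass under both distributions are still
  -- accepted, hence the identities are only claimed after multiplication by the masses.
  have acc' : ∀ x, P₀ x * accept P₀ P₁ (1 + γ) x = P₀ x * above P₀ P₁ x ∧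
      P₁ x * accept P₀ P₁ (1 + γ) x = P₁ x * above P₀ P₁ x := by
    intro x
    have hnn := hP₁.1 x
    have hle : P₁ x ≤ 1 :=
      hP₁.2 ▸ Finset.single_le_sum (fun x _ => hP₁.1 x) (Finset.mem_univ x)
    rcases lt_trichotomy (P₀ x) (P₁ x) with h | h | h
    · have : ¬ P₀ x ≥ (1 + γ) * P₁ x := by nlinarith
      simp [accept, above, this, h.not_gt]
    · rcases hnn.eq_or_lt with hz | hpos
      · simp [h, ← hz]
      · have : ¬ P₁ x ≥ (1 + γ) * P₁ x := by nlinarith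
        simp only [accept, above, h, this, lt_irrefl, if_false, and_self]
    · have h' := hsep x h.ne'
      rw [abs_of_pos (sub_pos.2 h)] at h'
      have : P₀ x ≥ (1 + γ) * P₁ x := by nlinarith
      simp [accept, above, this, h]
  have e₁ := sum_rpow_induced_binaryMechanism hP₀ hP₁ 1 l hε
    (a := P₀ ⬝ᵥ above P₀ P₁ + P₀ ⬝ᵥ tie P₀ P₁) (b := P₁ ⬝ᵥ above P₀ P₁ + P₀ ⬝ᵥ tie P₀ P₁)
    (by rw [acc, dotProduct_add]) (by rw [acc, dotProduct_add, ht])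
  have e₂ := sum_rpow_induced_binaryMechanism hP₀ hP₁ (1 + γ) l hε
    (a := P₀ ⬝ᵥ above P₀ P₁) (b := P₁ ⬝ᵥ above P₀ P₁)
    (Finset.sum_congr rfl fun x _ => (acc' x).1) (Finset.sum_congr rfl fun x _ => (acc' x).2)
  rw [show 1 - (P₀ ⬝ᵥ above P₀ P₁ + P₀ ⬝ᵥ tie P₀ P₁) = P₀ ⬝ᵥ above P₁ P₀ by linarith,
    show 1 - (P₁ ⬝ᵥ above P₀ P₁ + P₀ ⬝ᵥ tie P₀ P₁) = P₁ ⬝ᵥ above P₁ P₀ by linarith] at e₁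
  rw [show 1 - P₀ ⬝ᵥ above P₀ P₁ = P₀ ⬝ᵥ above P₁ P₀ + P₀ ⬝ᵥ tie P₀ P₁ by linarith,
    show 1 - P₁ ⬝ᵥ above P₀ P₁ = P₁ ⬝ᵥ above P₁ P₀ + P₀ ⬝ᵥ tie P₀ P₁ by linarith] at e₂
  have h2 : 0 < 2 + (Real.exp ε - 1) := by positivity
  rcases le_total
    (columnGap l (Real.exp ε - 1) (P₀ ⬝ᵥ above P₀ P₁ + P₀ ⬝ᵥ tie P₀ P₁)
        (P₁ ⬝ᵥ above P₀ P₁ + P₀ ⬝ᵥ tie P₀ P₁) +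
      columnGap l (Real.exp ε - 1) (P₀ ⬝ᵥ above P₁ P₀) (P₁ ⬝ᵥ above P₁ P₀))
    (columnGap l (Real.exp ε - 1) (P₀ ⬝ᵥ above P₀ P₁) (P₁ ⬝ᵥ above P₀ P₁) +
      columnGap l (Real.exp ε - 1) (P₀ ⬝ᵥ above P₁ P₀ + P₀ ⬝ᵥ tie P₀ P₁)
        (P₁ ⬝ᵥ above P₁ P₀ + P₀ ⬝ᵥ tie P₀ P₁)) with H | H
  · obtain ⟨n, hn, hcert⟩ := exists_certificate hP₀ hP₁ hsep hδ hεγ h0 h1 H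
    refine ⟨1 + γ, Or.inr rfl, ?_⟩
    rw [e₂, ← hn, mul_div_cancel_left₀ _ h2.ne']
    exact one_sub_sum_certificate_le hP₀ hP₁ hε hW hcert
  -- The opposite comparison is the same statement with the distributions exchanged and `l` replaced
  -- by `1 - l`.
  · have hsep' : ∀ x, P₁ x ≠ P₀ x → γ ≤ |P₁ x - P₀ x| :=
      fun x hx => abs_sub_comm (P₀ x) (P₁ x) ▸ hsep x hx.symm
    obtain ⟨n, hn, hcert⟩ := exists_certificate hP₁ hP₀ hsep' hδ hεγ (sub_nonneg.2 h1)
      (by linarith) (by simpa only [columnGap_swap, tie_comm P₀ P₁, ht, add_comm] using H)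
    simp only [columnGap_swap, tie_comm P₀ P₁, ht] at hn hcert
    refine ⟨1, Or.inl rfl, ?_⟩
    rw [e₁, add_comm (columnGap _ _ _ _), ← hn, mul_div_cancel_left₀ _ h2.ne']
    exact one_sub_sum_certificate_le hP₀ hP₁ hε hW hcert

/-- The better threshold may change with `l`. At each `l` the affinity of `W` is at least that of
one of the two mechanisms, whose logarithm is at least `-I`; taking the infimum over `l` keeps this
bound. -/
lemma inducedChernoff_le {X : Type*} [Fintype X] {P₀ P₁ : X → ℝ}
    (hP₀ : P₀ ∈ stdSimplex ℝ X) (hP₁ : P₁ ∈ stdSimplex ℝ X) {γ : ℝ} (hγ : 0 < γ)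
    (hsep : ∀ x, P₀ x ≠ P₁ x → γ ≤ |P₀ x - P₁ x|) {ε : ℝ} (hε : 0 ≤ ε)
    (hεγ : 16 * (Real.exp ε - 1) ≤ γ) {Y : Type*} [Fintype Y] {W : X → Y → ℝ} (hW : IsLDP ε W)
    {I : EReal} (hI : inducedChernoff P₀ P₁ (binaryMechanism P₀ P₁ 1 ε) ≤ I)
    (hI' : inducedChernoff P₀ P₁ (binaryMechanism P₀ P₁ (1 + γ) ε) ≤ I) :
    inducedChernoff P₀ P₁ W ≤ I := by
  refine EReal.neg_le_of_neg_le (le_iInf₂ fun l hl => ?_)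
  obtain ⟨τ, hτ, hle⟩ := exists_binaryMechanism_le hP₀ hP₁ hγ hsep hε hεγ hW hl.1.le hl.2.le
  have hτI : inducedChernoff P₀ P₁ (binaryMechanism P₀ P₁ τ ε) ≤ I := by
    rcases hτ with rfl | rfl <;> assumption
  exact (EReal.neg_le_of_neg_le hτI).trans <| (iInf₂_le l hl).trans <|
    ENNReal.log_monotone (ENNReal.ofReal_le_ofReal hle)

end LDP

theorem corollary5p4 {X : Type*} [Fintype X] (P₀ P₁ : X → ℝ)
    (hP₀ : P₀ ∈ stdSimplex ℝ X) (hP₁ : P₁ ∈ stdSimplex ℝ X) :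
    ∃ ε' : ℝ, 0 < ε' ∧ ∀ ε : ℝ, 0 ≤ ε → ε ≤ ε' →
      (∃ τ : ℝ, LDP.IsOptimalThreshold P₀ P₁ ε τ) ∧
      ∀ τ : ℝ, LDP.IsOptimalThreshold P₀ P₁ ε τ →
        LDP.IsLDP ε (LDP.binaryMechanism P₀ P₁ τ ε) ∧
        ∀ (Y : Type*) [Fintype Y] (W : X → Y → ℝ), LDP.IsLDP ε W →
          LDP.inducedChernoff P₀ P₁ W ≤
            LDP.inducedChernoff P₀ P₁ (LDP.binaryMechanism P₀ P₁ τ ε) := by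
  obtain ⟨γ, hγ, hsep⟩ := LDP.exists_pos_le_of_ne_zero fun x => P₀ x - P₁ x
  replace hsep : ∀ x, P₀ x ≠ P₁ x → γ ≤ |P₀ x - P₁ x| := fun x hx => hsep x (sub_ne_zero.2 hx)
  -- This choice makes `ε ≤ ε'` equivalent to `16 * (exp ε - 1) ≤ γ`.
  refine ⟨Real.log (1 + γ / 16), Real.log_pos (by linarith), fun ε hε hε' => ?_⟩
  have hεγ : 16 * (Real.exp ε - 1) ≤ γ := by
    have := (Real.le_log_iff_exp_le (by positivity)).1 hε'
    linarith
  refine ⟨?_, fun τ hτ => ⟨LDP.isLDP_binaryMechanism P₀ P₁ τ hε, fun Y _ W hW =>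
    LDP.inducedChernoff_le hP₀ hP₁ hγ hsep hε hεγ hW (hτ.2 1 one_pos)
      (hτ.2 (1 + γ) (by positivity))⟩⟩
  -- Binary mechanisms are themselves private, so the better of the thresholds `1` and `1 + γ` beats
  -- every other threshold.
  rcases le_total (LDP.inducedChernoff P₀ P₁ (LDP.binaryMechanism P₀ P₁ 1 ε))
    (LDP.inducedChernoff P₀ P₁ (LDP.binaryMechanism P₀ P₁ (1 + γ) ε)) with h | h
  · exact ⟨1 + γ, by positivity, fun τ' _ => LDP.inducedChernoff_le hP₀ hP₁ hγ hsep hε hεγ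
      (LDP.isLDP_binaryMechanism P₀ P₁ τ' hε) h le_rfl⟩
  · exact ⟨1, one_pos, fun τ' _ => LDP.inducedChernoff_le hP₀ hP₁ hγ hsep hε hεγ
      (LDP.isLDP_binaryMechanism P₀ P₁ τ' hε) le_rfl h⟩
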